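/- A machine has a state $X(t)\in\{0,1,2\}$ (free, busy with an internal job, busy with an external job). Internal jobs arrive at rate $\alpha>0$ while $X=0$ and move $X$ to $1$; internal jobs are completed at rate $\beta>0$ and external jobs at rate $\gamma>0$, which moves $X$ back to $0$. A resource allocator (RA) keeps an estimate $\hat X(t)$ of $X(t)$ and samples the machine at rate $\mu\ge 0$; a sample sets $\hat X$ to $X$. External job requests arrive at the RA at rate $\lambda>0$ and are accepted if $\hat X=0$ and rejected (without effect) if $\hat X\neq 0$. An accepted request is assigned to the machine: if $X=0$, then $X$ and $\hat X$ become $2$; if $X=1$, the request is lost (a false acceptance), and $\hat X$ becomes $1$. A false rejection is a rejection while $X=0$. All event times are exponential and independent, so that $Y=(X,\hat X)$ is a continuous-time Markov chain on $S=\{0,1\}\times\{0,1\}\cup\{0,1,2\}\times\{2\}$; let $X(0)=\hat X(0)=0$. Let $N_A(T),N_{FA}(T),N_R(T),N_{FR}(T)$ be the numbers of acceptances, false acceptances, rejections and false rejections by time $T$, and $$\mathrm{FAR}=\mathbb E\Big[\limsup_{T\to\infty}\frac{N_{FA}(T)}{N_A(T)}\Big],\qquad \mathrm{FRR}=\mathbb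 E\Big[\limsup_{T\to\infty}\frac{N_{FR}(T)}{N_R(T)}\Big].$$ Put $\kappa=\lambda+\alpha+\beta$ and $\tilde\beta=\lambda\beta(\lambda+\beta)+\gamma(\lambda\beta+\lambda\alpha+\alpha\kappa)$. Theorem: when $\mu=0$, the chain $Y$ is not recurrent, and nevertheless the FAR and the FRR of the system with $\mu=0$ are the limits of the closed forms of these ratios for sampling rates $\mu>0$: $$\mathrm{FAR}=\lim_{\mu\to0^+}\frac{\alpha}{\mu+\kappa}=\frac{\alpha}{\kappa},\qquad \mathrm{FRR}=\lim_{\mu\to0^+}\frac{\gamma\beta(\mu(\lambda+\alpha)+\lambda\kappa)}{(\alpha\gamma+\lambda\beta)\mu^2+\tilde\beta\mu+\gamma\lambda(\beta+\alpha)\kappa}=\frac{\beta}{\alpha+\beta}.$$ -/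

import Mathlib

open MeasureTheory ProbabilityTheory Filter Topology

noncomputable section

namespace MarkovMachine

/-- The rates of a single Markov machine monitored by a resource allocator (RA): internal jobs
arrive at rate `alpha` while the machine is free, internal jobs are completed at rate `beta`,
external jobs are completed at rate `gamma`, external job requests arrive at the RA at rate `lam`,
and the RA samples the machine at rate `mu` (where `mu = 0` means that it never samples). -/
structure Rates where
  alpha : ℝ
  beta : ℝ
  gamma : ℝ
  lam : ℝ
  mu : ℝ
  alpha_pos : 0 < alpha
  beta_pos : 0 < beta
  gamma_pos : 0 < gamma
  lam_pos : 0 < lam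
  mu_nonneg : 0 ≤ mu

/-- The state space `S = {0,1} × {0,1} ∪ {0,1,2} × {2}` of the pair `(X, X̂)`: `X` is the state of
the machine (`0` free, `1` busy with an internal job, `2` busy with an external job), and `X̂` is
the estimate that the RA has of it. -/
abbrev State : Type := {y : Fin 3 × Fin 3 // y.1 = 2 → y.2 = 2}

/-- The initial state `X(0) = X̂(0) = 0`. -/
def start : State := ⟨(0, 0), by decide⟩

/-- The types of events: an internal event of the machine (arrival of an internal job if `X = 0`,
completion of the current job if `X = 1` or `X = 2`), the arrival of an external job request at the
RA, and the sampling of the machine by the RA. -/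
inductive Event : Type
  | internal
  | request
  | sample

instance : MeasurableSpace Event := ⊤

/-- The machine is free in state `y`. -/
def Free (y : State) : Prop := y.1.1 = 0

/-- In state `y` the RA accepts external job requests, i.e. `X̂ = 0`. -/
def Accepts (y : State) : Prop := y.1.2 = 0

/-- The state after an event. An internal event moves `X` from `0` to `1` and from `1` or `2`
to `0`. A request is rejected without any effect if `X̂ ≠ 0`; if `X̂ = 0` it is accepted and
assigned, so that a free machine starts to process it, a busy machine loses it, and in both cases
the RA learns the state of the machine. Sampling sets `X̂` to `X`. -/
def step (y : State) : Event → State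
  | .internal => ⟨(if y.1.1 = 0 then 1 else 0, y.1.2), by intro h; split at h <;> simp at h⟩
  | .request =>
      if y.1.2 = 0 then
        (if y.1.1 = 0 then ⟨(2, 2), fun _ => rfl⟩ else ⟨(y.1.1, y.1.1), fun h => h⟩)
      else y
  | .sample => ⟨(y.1.1, y.1.1), fun h => h⟩

namespace Rates

variable (r : Rates)

/-- The rate of internal events, as a function of the state `X` of the machine. -/
def internalRate (x : Fin 3) : ℝ := ![r.alpha, r.beta, r.gamma] x

/-- The rate at which events of a given type occur in state `y`. -/
def rate (y : State) : Event → ℝ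
  | .internal => r.internalRate y.1.1
  | .request => r.lam
  | .sample => r.mu

/-- The total rate of events in state `y`, including those that do not change the state. -/
def totalRate (y : State) : ℝ :=
  r.rate y .internal + r.rate y .request + r.rate y .sample

lemma rate_nonneg (y : State) (e : Event) : 0 ≤ r.rate y e := by
  cases e with
  | internal =>
    obtain ⟨⟨x, z⟩, h⟩ := y
    fin_cases x
    · exact r.alpha_pos.le
    · exact r.beta_pos.le
    · exact r.gamma_pos.le
  | request => exact r.lam_pos.le
  | sample => exact r.mu_nonneg

lemma totalRate_pos (y : State) : 0 < r.totalRate y := by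
  have h1 := r.rate_nonneg y .internal
  have h2 := r.lam_pos
  have h3 := r.mu_nonneg
  simp only [totalRate, rate] at *
  linarith

/-- The law of the type of the next event in state `y`: each type has a probability proportional
to its rate. -/
def eventLaw (y : State) : Measure Event :=
  ENNReal.ofReal (r.rate y .internal / r.totalRate y) • Measure.dirac .internal
    + ENNReal.ofReal (r.rate y .request / r.totalRate y) • Measure.dirac .request
    + ENNReal.ofReal (r.rate y .sample / r.totalRate y) • Measure.dirac .sample

instance (y : State) : IsProbabilityMeasure (r.eventLaw y) := by
  constructor
  have h := r.totalRate_pos y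
  have h0 := fun e => div_nonneg (r.rate_nonneg y e) h.le
  simp only [eventLaw, Measure.add_apply, Measure.smul_apply, measure_univ, smul_eq_mul, mul_one]
  rw [← ENNReal.ofReal_add (h0 _) (h0 _), ← ENNReal.ofReal_add (add_nonneg (h0 _) (h0 _)) (h0 _),
    ← add_div, ← add_div]
  have h1 : (r.rate y .internal + r.rate y .request + r.rate y .sample) / r.totalRate y = 1 :=
    div_self h.ne'
  rw [h1, ENNReal.ofReal_one]

instance (y : State) : IsProbabilityMeasure (expMeasure (r.totalRate y)) :=
  isProbabilityMeasure_expMeasure (r.totalRate_pos y)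

end Rates

/-- One period between consecutive events: the state `Y` during the period, the length of the
period, and the type of the event that ends it. -/
abbrev Period : Type := State × ℝ × Event

namespace Period

/-- The state during the period. -/
def state (z : Period) : State := z.1

/-- The length of the period. -/
def hold (z : Period) : ℝ := z.2.1

/-- The type of the event that ends the period. -/
def event (z : Period) : Event := z.2.2

/-- The state in the next period. -/
def next (z : Period) : State := step z.state z.event

end Period

lemma measurable_next : Measurable Period.next := by
  have h : Measurable (fun p : State × Event => step p.1 p.2) :=
    measurable_from_prod_countable_right (fun _ => measurable_from_top)
  exact h.comp (measurable_fst.prodMk (measurable_snd.comp measurable_snd))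

namespace Rates

variable (r : Rates)

/-- The law of a period in state `y`: its length is exponential with the total rate of events in
`y`, and the type of the event that ends it is independent of the length. -/
def periodLaw : Kernel State Period where
  toFun y := (Measure.dirac y).prod ((expMeasure (r.totalRate y)).prod (r.eventLaw y))
  measurable' := Measurable.of_discrete

instance : IsMarkovKernel r.periodLaw :=
  ⟨fun y => inferInstanceAs (IsProbabilityMeasure
    ((Measure.dirac y).prod ((expMeasure (r.totalRate y)).prod (r.eventLaw y))))⟩

/-- The law of the sequence of periods of the continuous-time Markov chain `Y = (X, X̂)` started
in `y`: the first period is in state `y`, and given the past, the next period has the law of a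
period in the state that the last event has led to. -/
def law (y : State) : Measure (ℕ → Period) :=
  Kernel.trajMeasure (X := fun _ => Period) (r.periodLaw y)
    (fun n => r.periodLaw.comap (fun h => (h ⟨n, Finset.mem_Iic.2 le_rfl⟩).next)
      (measurable_next.comp (measurable_pi_apply _)))

end Rates

/-- The time at which period `n` ends, i.e. the time of the event with index `n`. -/
def epoch (ω : ℕ → Period) (n : ℕ) : ℝ := ∑ k ∈ Finset.range (n + 1), (ω k).hold

/-- The number of indices `n` with property `p` whose event occurs by time `t`. (Almost surely the
epochs tend to infinity, so that this is the cardinality of a finite set.) -/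
def count (ω : ℕ → Period) (p : Period → Prop) (t : ℝ) : ℕ :=
  {n : ℕ | epoch ω n ≤ t ∧ p (ω n)}.ncard

/-- The state `Y(t) = (X(t), X̂(t))`. -/
def stateAt (ω : ℕ → Period) (t : ℝ) : State := (ω (count ω (fun _ => True) t)).state

/-- The number of requests that the RA has accepted by time `t`. -/
def numAccepted (ω : ℕ → Period) (t : ℝ) : ℕ :=
  count ω (fun z => z.event = .request ∧ Accepts z.state) t

/-- The number of requests that the RA has accepted by time `t` although the machine was busy. -/
def numFalseAccepted (ω : ℕ → Period) (t : ℝ) : ℕ :=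
  count ω (fun z => z.event = .request ∧ Accepts z.state ∧ ¬ Free z.state) t

/-- The number of requests that the RA has rejected by time `t`. -/
def numRejected (ω : ℕ → Period) (t : ℝ) : ℕ :=
  count ω (fun z => z.event = .request ∧ ¬ Accepts z.state) t

/-- The number of requests that the RA has rejected by time `t` although the machine was free. -/
def numFalseRejected (ω : ℕ → Period) (t : ℝ) : ℕ :=
  count ω (fun z => z.event = .request ∧ ¬ Accepts z.state ∧ Free z.state) t

/-- The upper limit, as `T → ∞`, of the proportion of false acceptances among acceptances. -/
def limsupFA (ω : ℕ → Period) : ℝ :=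
  limsup (fun T : ℝ => (numFalseAccepted ω T : ℝ) / (numAccepted ω T : ℝ)) atTop

/-- The upper limit, as `T → ∞`, of the proportion of false rejections among rejections. -/
def limsupFR (ω : ℕ → Period) : ℝ :=
  limsup (fun T : ℝ => (numFalseRejected ω T : ℝ) / (numRejected ω T : ℝ)) atTop

namespace Rates

variable (r : Rates)

/-- The false acceptance ratio of the system started in `X(0) = X̂(0) = 0`. -/
def FAR : ℝ := ∫ ω, limsupFA ω ∂(r.law start)

/-- The false rejection ratio of the system started in `X(0) = X̂(0) = 0`. -/
def FRR : ℝ := ∫ ω, limsupFR ω ∂(r.law start)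

/-- The chain `Y(t)` is recurrent: from every state `y`, it almost surely is in `y` at arbitrarily
large times. -/
def Recurrent : Prop :=
  ∀ y : State, ∀ᵐ ω ∂(r.law y), ∀ T : ℝ, ∃ t ≥ T, stateAt ω t = y

/-- The constant `κ = λ + α + β`. -/
def kappa : ℝ := r.lam + r.alpha + r.beta

/-- The closed form of the false acceptance ratio at a sampling rate `m > 0`, the other rates being
those of `r`. -/
def closedFAR (m : ℝ) : ℝ := r.alpha / (m + r.kappa)

/-- The constant `β̃` in the closed form of the false rejection ratio. -/
def betaTilde : ℝ :=
  r.lam * r.beta * (r.lam + r.beta)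
    + r.gamma * (r.lam * r.beta + r.lam * r.alpha + r.alpha * r.kappa)

/-- The closed form of the false rejection ratio at a sampling rate `m > 0`, the other rates being
those of `r`. -/
def closedFRR (m : ℝ) : ℝ :=
  r.gamma * r.beta * (m * (r.lam + r.alpha) + r.lam * r.kappa)
    / ((r.alpha * r.gamma + r.lam * r.beta) * m ^ 2 + r.betaTilde * m
      + r.gamma * r.lam * (r.beta + r.alpha) * r.kappa)

end Rates

end MarkovMachine

end

/-! Without sampling, $\hat X$ stays $0$ until the first request, which is accepted and makes $\hat
X$ nonzero for good (`Regular.dichotomy`). So `start` is not revisited at large times, and the ratio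
of false acceptances is eventually the indicator that the first request finds the machine busy. Its
mean comes from a martingale: false acceptances plus `acceptancePotential` have zero drift, the
value at `start` is $\alpha/\kappa$, and dominated convergence passes this value to the limit.

For rejections, `rejectionPotential` solves the Poisson equation for false rejections minus
$\beta/(\alpha+\beta)$ times rejections. The compensated sums have bounded orthogonal increments, so
they are $o(n)$ by `ae_tendsto_average_zero`. Requests grow linearly and only one is accepted, so
the ratio converges almost surely.

All this is done in event index; `Regular.exists_clock` transfers it to real time, as the epochs
tend to infinity. The closed forms are continuous at $0$ and have these values there. -/

open MeasureTheory ProbabilityTheory Filter Topology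

noncomputable section

/-! ### A strong law from orthogonality -/

/-- A strong law of large numbers for bounded orthogonal random variables. -/
theorem ae_tendsto_average_zero_of_orthogonal {Ω : Type*} [MeasurableSpace Ω] {P : Measure Ω}
    [IsProbabilityMeasure P] {D : ℕ → Ω → ℝ} {C : ℝ} (hm : ∀ n, Measurable (D n))
    (hC : ∀ n ω, |D n ω| ≤ C) (horth : ∀ i j, i < j → ∫ ω, D i ω * D j ω ∂P = 0) :
    ∀ᵐ ω ∂P, Tendsto (fun n : ℕ => (∑ k ∈ Finset.range n, D k ω) / n) atTop (𝓝 0) := by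
  set S : ℕ → Ω → ℝ := fun n ω => ∑ k ∈ Finset.range n, D k ω with hS
  have hC0 : 0 ≤ C := by
    obtain ⟨ω⟩ : Nonempty Ω := by
      by_contra h
      rw [not_nonempty_iff] at h
      exact IsProbabilityMeasure.ne_zero P (Measure.eq_zero_of_isEmpty P)
    exact (abs_nonneg _).trans (hC 0 ω)
  have hSm : ∀ n, Measurable (S n) := fun n => Finset.measurable_sum _ fun k _ => hm k
  have hSb : ∀ n ω, |S n ω| ≤ n * C := fun n ω => by
    refine (Finset.abs_sum_le_sum_abs _ _).trans ?_
    refine (Finset.sum_le_sum fun k _ => hC k ω).trans ?_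
    simp
  have hint : ∀ {f : Ω → ℝ} (K : ℝ), Measurable f → (∀ ω, |f ω| ≤ K) → Integrable f P :=
    fun K hf hK => Integrable.of_bound hf.aestronglyMeasurable K (ae_of_all _ hK)
  have hDD : ∀ i j, Integrable (fun ω => D i ω * D j ω) P := fun i j =>
    hint (C * C) ((hm i).mul (hm j)) fun ω => by
      rw [abs_mul]; exact mul_le_mul (hC i ω) (hC j ω) (abs_nonneg _) hC0
  have hSq : ∀ n, ∫ ω, S n ω ^ 2 ∂P ≤ n * C ^ 2 := by
    intro n
    induction n with
    | zero => simp [hS]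
    | succ n ih =>
      have hcross : ∫ ω, S n ω * D n ω ∂P = 0 := by
        simp only [hS, Finset.sum_mul]
        rw [integral_finsetSum _ fun i _ => hDD i n]
        exact Finset.sum_eq_zero fun i hi => horth i n (Finset.mem_range.1 hi)
      have i1 : Integrable (fun ω => S n ω ^ 2) P :=
        hint ((n * C) ^ 2) ((hSm n).pow_const 2) fun ω => by
          rw [abs_pow]; exact pow_le_pow_left₀ (abs_nonneg _) (hSb n ω) 2
      have i2 : Integrable (fun ω => S n ω * D n ω) P := by
        simp only [hS, Finset.sum_mul]
        exact integrable_finsetSum _ fun i _ => hDD i n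
      have i3 : Integrable (fun ω => D n ω ^ 2) P := by
        simpa only [pow_two] using hDD n n
      have e : (fun ω => S (n + 1) ω ^ 2)
          = fun ω => S n ω ^ 2 + (2 * (S n ω * D n ω) + D n ω ^ 2) := by
        funext ω
        simp only [hS, Finset.sum_range_succ]
        ring
      have h3 : ∫ ω, D n ω ^ 2 ∂P ≤ C ^ 2 := by
        calc ∫ ω, D n ω ^ 2 ∂P ≤ ∫ _, C ^ 2 ∂P := by
              refine integral_mono i3 (integrable_const _) fun ω => ?_
              simpa using pow_le_pow_left₀ (abs_nonneg _) (hC n ω) 2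
          _ = C ^ 2 := by simp
      have i4 : Integrable (fun ω => 2 * (S n ω * D n ω) + D n ω ^ 2) P := (i2.const_mul 2).add i3
      rw [e, integral_add i1 i4, integral_add (i2.const_mul 2) i3,
        integral_const_mul, hcross]
      push_cast
      linarith
  -- Along squares, the second moments of the averages are at most $C^2/k^2$, which is summable;
  -- hence the squared averages are almost surely summable and tend to $0$.
  have hsub : ∀ᵐ ω ∂P, Tendsto (fun k : ℕ => S (k ^ 2) ω / (k : ℝ) ^ 2) atTop (𝓝 0) := by
    have hf : ∀ k : ℕ, Measurable fun ω => ENNReal.ofReal ((S (k ^ 2) ω / (k : ℝ) ^ 2) ^ 2) :=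
      fun k => (((hSm _).div_const _).pow_const 2).ennreal_ofReal
    have hle : ∀ k : ℕ, ∫⁻ ω, ENNReal.ofReal ((S (k ^ 2) ω / (k : ℝ) ^ 2) ^ 2) ∂P
        ≤ ENNReal.ofReal (C ^ 2 * (1 / (k : ℝ) ^ 2)) := by
      intro k
      have i1 : Integrable (fun ω => (S (k ^ 2) ω / (k : ℝ) ^ 2) ^ 2) P :=
        hint (((k ^ 2 : ℕ) * C / (k : ℝ) ^ 2) ^ 2) (((hSm _).div_const _).pow_const 2) fun ω => by
          rw [abs_pow, abs_div, abs_of_nonneg (by positivity : (0 : ℝ) ≤ (k : ℝ) ^ 2)]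
          gcongr
          exact hSb _ ω
      rw [← ofReal_integral_eq_lintegral_ofReal i1 (ae_of_all _ fun ω => sq_nonneg _)]
      refine ENNReal.ofReal_le_ofReal ?_
      simp only [div_pow]
      rw [integral_div]
      rcases Nat.eq_zero_or_pos k with rfl | hk
      · simp
      have hk' : (0 : ℝ) < k := by exact_mod_cast hk
      rw [div_le_iff₀ (by positivity)]
      refine (hSq _).trans (le_of_eq ?_)
      push_cast
      field_simp
    have hsum : ∫⁻ ω, ∑' k : ℕ, ENNReal.ofReal ((S (k ^ 2) ω / (k : ℝ) ^ 2) ^ 2) ∂P ≠ ⊤ := by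
      rw [lintegral_tsum fun k => (hf k).aemeasurable]
      refine ne_top_of_le_ne_top ?_ (ENNReal.tsum_le_tsum hle)
      have hs : Summable fun k : ℕ => C ^ 2 * (1 / (k : ℝ) ^ 2) :=
        (Real.summable_one_div_nat_pow.2 one_lt_two).mul_left _
      exact hs.tsum_ofReal_ne_top
    filter_upwards [ae_lt_top (Measurable.tsum hf) hsum] with ω hω
    have h1 := ENNReal.tendsto_atTop_zero_of_tsum_ne_top hω.ne
    have h2 := (ENNReal.tendsto_toReal ENNReal.zero_ne_top).comp h1
    have h3 : Tendsto (fun k : ℕ => (S (k ^ 2) ω / (k : ℝ) ^ 2) ^ 2) atTop (𝓝 0) := by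
      refine h2.congr fun k => ?_
      simp [ENNReal.toReal_ofReal, sq_nonneg]
    have h4 := h3.sqrt
    simp only [Real.sqrt_sq_eq_abs, Real.sqrt_zero] at h4
    exact (tendsto_zero_iff_abs_tendsto_zero _).2 h4
  filter_upwards [hsub] with ω hω
  have hsqrt : Tendsto Nat.sqrt atTop atTop :=
    tendsto_atTop.2 fun b => (eventually_ge_atTop (b * b)).mono fun n hn => Nat.le_sqrt.2 hn
  -- For $k=\lfloor\sqrt n\rfloor$, at most $2k$ terms separate $n$ from $k^2$; divided by $k^2$
  -- they contribute at most $2C/k$.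
  have hlim : Tendsto (fun k : ℕ => |S (k ^ 2) ω / (k : ℝ) ^ 2| + 2 * C / k) atTop (𝓝 0) := by
    simpa using hω.abs.add (tendsto_const_div_atTop_nhds_zero_nat (2 * C))
  refine squeeze_zero_norm' ?_ (hlim.comp hsqrt)
  filter_upwards [eventually_ge_atTop 1] with n hn
  set k := Nat.sqrt n with hk
  have hk1 : 1 ≤ k := Nat.le_sqrt.2 (by omega)
  have hkn : k ^ 2 ≤ n := by rw [pow_two]; exact Nat.sqrt_le n
  have hnk : n ≤ k ^ 2 + 2 * k := by
    have := Nat.sqrt_le_add n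
    rw [← hk] at this
    nlinarith
  have hk0 : (0 : ℝ) < k := by exact_mod_cast hk1
  have hkn' : (k : ℝ) ^ 2 ≤ n := by exact_mod_cast hkn
  have hdiff : |S n ω - S (k ^ 2) ω| ≤ 2 * k * C := by
    have : S n ω - S (k ^ 2) ω = ∑ i ∈ Finset.Ico (k ^ 2) n, D i ω := by
      rw [Finset.sum_Ico_eq_sub _ hkn]
    rw [this]
    refine (Finset.abs_sum_le_sum_abs _ _).trans ?_
    refine (Finset.sum_le_sum fun i _ => hC i ω).trans ?_
    simp only [Finset.sum_const, Nat.card_Ico, nsmul_eq_mul]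
    refine mul_le_mul_of_nonneg_right ?_ hC0
    exact_mod_cast (by omega : n - k ^ 2 ≤ 2 * k)
  have hSn : |S n ω| ≤ |S (k ^ 2) ω| + 2 * k * C := by
    have := abs_add_le (S (k ^ 2) ω) (S n ω - S (k ^ 2) ω)
    rw [add_sub_cancel] at this
    linarith
  have hk2 : (0 : ℝ) < (k : ℝ) ^ 2 := by positivity
  simp only [Function.comp, Real.norm_eq_abs, abs_div, Nat.abs_cast, abs_pow]
  calc |S n ω| / n ≤ (|S (k ^ 2) ω| + 2 * k * C) / (k : ℝ) ^ 2 :=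
        div_le_div₀ (by positivity) hSn hk2 hkn'
    _ = |S (k ^ 2) ω| / (k : ℝ) ^ 2 + 2 * C / k := by field_simp

/-! ### One-step means, the Markov property and laws of large numbers -/

namespace MarkovMachine

instance : DiscreteMeasurableSpace Event := ⟨fun _ => trivial⟩

instance : Finite Event :=
  Finite.of_injective (fun e : Event => (match e with
    | .internal => 0
    | .request => 1
    | .sample => 2 : Fin 3)) (by rintro (_ | _ | _) (_ | _ | _) h <;> simp_all)

namespace Period

lemma measurable_state : Measurable state := measurable_fst

lemma measurable_hold : Measurable hold := measurable_fst.comp measurable_snd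

lemma measurable_event : Measurable event := measurable_snd.comp measurable_snd

/-- Every function of the state and the event of a period is measurable. -/
lemma measurable_comp_state_event {β : Type*} [MeasurableSpace β] (g : State → Event → β) :
    Measurable fun z : Period => g z.state z.event :=
  (Measurable.of_discrete (f := fun p : State × Event => g p.1 p.2)).comp
    (measurable_state.prodMk measurable_event)

/-- A function of the state and the event of a period is bounded. -/
lemma exists_bound (g : State → Event → ℝ) : ∃ C, ∀ y e, |g y e| ≤ C := by
  obtain ⟨C, hC⟩ := (Set.finite_range fun p : State × Event => |g p.1 p.2|).bddAbove
  exact ⟨C, fun y e => hC ⟨(y, e), rfl⟩⟩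

end Period

namespace Rates

variable (r : Rates)

instance (y : State) : IsProbabilityMeasure (r.law y) :=
  inferInstanceAs (IsProbabilityMeasure (Kernel.trajMeasure _ _))

lemma periodLaw_apply (y : State) : r.periodLaw y
    = (Measure.dirac y).prod ((expMeasure (r.totalRate y)).prod (r.eventLaw y)) := rfl

lemma integral_eventLaw (y : State) (g : Event → ℝ) : ∫ e, g e ∂r.eventLaw y
    = (r.rate y .internal * g .internal + r.rate y .request * g .request
      + r.rate y .sample * g .sample) / r.totalRate y := by
  have h := fun e => div_nonneg (r.rate_nonneg y e) (r.totalRate_pos y).le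
  have hi : ∀ μ : Measure Event, IsFiniteMeasure μ → Integrable g μ :=
    fun μ _ => Integrable.of_finite
  rw [eventLaw, integral_add_measure, integral_add_measure, integral_smul_measure,
    integral_smul_measure, integral_smul_measure]
  · simp only [integral_dirac, ENNReal.toReal_ofReal (h _), smul_eq_mul]
    ring
  all_goals
    refine hi _ ⟨?_⟩
    simp [ENNReal.add_lt_top]

/-- The mean, over a period in state `y`, of a function of the state and of the event. -/
lemma integral_periodLaw (y : State) (g : State → Event → ℝ) :
    ∫ z, g z.state z.event ∂r.periodLaw y
      = (r.rate y .internal * g y .internal + r.rate y .request * g y .request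
        + r.rate y .sample * g y .sample) / r.totalRate y := by
  obtain ⟨C, hC⟩ := Period.exists_bound g
  rw [← integral_eventLaw, periodLaw_apply, integral_prod, integral_dirac, integral_prod]
  · simp [Period.state, Period.event]
  all_goals
    refine Integrable.of_bound (C := C) (Measurable.aestronglyMeasurable ?_)
      (ae_of_all _ fun z => hC _ _)
  · exact (Period.measurable_comp_state_event g).comp measurable_prodMk_left
  · exact Period.measurable_comp_state_event g

/-- The density vanishes on the negative half-line, and the point $0$ is Lebesgue-null. -/
lemma expMeasure_ae_pos (c : ℝ) : ∀ᵐ x ∂expMeasure c, 0 < x := by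
  have h : expMeasure c (Set.Iic 0) = 0 := by
    rw [expMeasure, gammaMeasure, withDensity_apply _ measurableSet_Iic]
    rw [setLIntegral_congr (Iio_ae_eq_Iic (μ := volume)).symm]
    exact lintegral_gammaPDF_of_nonpos le_rfl
  refine measure_mono_null (fun x hx => ?_) h
  simpa using hx

/-- Almost surely, a period in state `y` is in that state and has a positive length. If the
sampling rate vanishes, then it does not end with a sampling. -/
lemma ae_periodLaw (hr : r.mu = 0) (y : State) :
    ∀ᵐ z ∂r.periodLaw y, z.state = y ∧ 0 < z.hold ∧ z.event ≠ .sample := by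
  have h1 : ∀ᵐ z ∂r.periodLaw y, z.state = y := by
    have h : ∀ᵐ x ∂Measure.dirac y, x = y := by simp [ae_dirac_eq]
    exact Measure.quasiMeasurePreserving_fst.ae h
  have h2 : ∀ᵐ z ∂r.periodLaw y, 0 < z.hold :=
    (Measure.quasiMeasurePreserving_fst.comp Measure.quasiMeasurePreserving_snd).ae
      (expMeasure_ae_pos _)
  have h3 : ∀ᵐ z ∂r.periodLaw y, z.event ≠ .sample := by
    have h : ∀ᵐ e ∂r.eventLaw y, e ≠ .sample := by
      simp [ae_iff, eventLaw, rate, hr]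
    exact (Measure.quasiMeasurePreserving_snd.comp Measure.quasiMeasurePreserving_snd).ae h
  filter_upwards [h1, h2, h3] with z a b c using ⟨a, b, c⟩

/-- The first period is a period in the initial state. -/
lemma map_law_zero (y : State) : (r.law y).map (fun ω => ω 0) = r.periodLaw y := by
  have h : (fun ω : ℕ → Period => ω 0)
      = (fun x : (Π _ : Finset.Iic 0, Period) => x ⟨0, by simp⟩) ∘ Preorder.frestrictLe 0 := rfl
  rw [h, ← Measure.map_map (by fun_prop) (by fun_prop), law, Kernel.trajMeasure,
    Measure.map_comp _ _ (by fun_prop), Kernel.traj_map_frestrictLe, Kernel.partialTraj_self,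
    Measure.id_comp, Measure.map_map (by fun_prop) (by fun_prop)]
  exact Measure.map_id

/-- Given the past, the next period has the law of a period in the next state. -/
lemma map_law_succ (y : State) (n : ℕ) :
    (r.law y).map (fun ω => (Preorder.frestrictLe (π := fun _ => Period) n ω, ω (n + 1)))
      = (r.law y).map (Preorder.frestrictLe (π := fun _ => Period) n)
        ⊗ₘ r.periodLaw.comap (fun h => (h ⟨n, Finset.mem_Iic.2 le_rfl⟩).next)
          (measurable_next.comp (measurable_pi_apply _)) :=
  Kernel.map_frestrictLe_trajMeasure_compProd_eq_map_trajMeasure.symm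

lemma ae_law_zero (y : State) {p : Period → Prop} (h : ∀ᵐ z ∂r.periodLaw y, p z) :
    ∀ᵐ ω ∂r.law y, p (ω 0) := by
  rw [← map_law_zero] at h
  exact ae_of_ae_map (measurable_pi_apply 0).aemeasurable h

/-- By the disintegration `map_law_succ`, what is almost sure under every one-step kernel is almost
sure along the path. This is how the dynamics become pathwise facts. -/
lemma ae_law_succ (y : State) {p : State → Period → Prop} (h : ∀ y', ∀ᵐ z ∂r.periodLaw y', p y' z)
    (hp : MeasurableSet {x : State × Period | p x.1 x.2}) (n : ℕ) :
    ∀ᵐ ω ∂r.law y, p (ω n).next (ω (n + 1)) := by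
  have hn : Measurable fun x : Π _ : Finset.Iic n, Period =>
      (x ⟨n, Finset.mem_Iic.2 le_rfl⟩).next := measurable_next.comp (measurable_pi_apply _)
  have h' : ∀ᵐ x ∂(r.law y).map (fun ω => (Preorder.frestrictLe (π := fun _ => Period) n ω,
      ω (n + 1))), p (x.1 ⟨n, Finset.mem_Iic.2 le_rfl⟩).next x.2 := by
    rw [map_law_succ]
    refine (Measure.ae_compProd_iff ?_).2 (ae_of_all _ fun x => h _)
    exact hp.preimage ((hn.comp measurable_fst).prodMk measurable_snd)
  exact ae_of_ae_map (by fun_prop) h'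

lemma integral_law_zero (y : State) {f : Period → ℝ} (hf : Measurable f) :
    ∫ ω, f (ω 0) ∂r.law y = ∫ z, f z ∂r.periodLaw y := by
  rw [← map_law_zero, integral_map (measurable_pi_apply 0).aemeasurable hf.aestronglyMeasurable]

/-- A bounded function of a period that has mean zero in every state is orthogonal to the past. -/
lemma integral_law_mul_succ_eq_zero (y : State) (n : ℕ) {f : Period → ℝ} {C K : ℝ}
    (hf : Measurable f) (hC : ∀ z, |f z| ≤ C) (h0 : ∀ y', ∫ z, f z ∂r.periodLaw y' = 0)
    {G : (Π _ : Finset.Iic n, Period) → ℝ} (hG : Measurable G) (hK : ∀ x, |G x| ≤ K) :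
    ∫ ω, G (Preorder.frestrictLe (π := fun _ => Period) n ω) * f (ω (n + 1)) ∂r.law y = 0 := by
  have hm : Measurable fun x : (Π _ : Finset.Iic n, Period) × Period => G x.1 * f x.2 :=
    (hG.comp measurable_fst).mul (hf.comp measurable_snd)
  have e := integral_map (μ := r.law y)
    (φ := fun ω => (Preorder.frestrictLe (π := fun _ => Period) n ω, ω (n + 1)))
    (by fun_prop) hm.aestronglyMeasurable
  rw [← e, map_law_succ]
  have : IsProbabilityMeasure ((r.law y).map (Preorder.frestrictLe (π := fun _ => Period) n)) :=
    Measure.isProbabilityMeasure_map (by fun_prop)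
  rw [Measure.integral_compProd]
  · simp only [Kernel.comap_apply, integral_const_mul, h0, mul_zero, integral_zero]
  · refine Integrable.of_bound (C := K * C) hm.aestronglyMeasurable (ae_of_all _ fun x => ?_)
    rw [Real.norm_eq_abs, abs_mul]
    exact mul_le_mul (hK _) (hC _) (abs_nonneg _) ((abs_nonneg _).trans (hK x.1))

lemma integral_law_eq_zero (y : State) {f : Period → ℝ} {C : ℝ} (hf : Measurable f)
    (hC : ∀ z, |f z| ≤ C) (h0 : ∀ y', ∫ z, f z ∂r.periodLaw y' = 0) (n : ℕ) :
    ∫ ω, f (ω n) ∂r.law y = 0 := by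
  cases n with
  | zero => rw [integral_law_zero r y hf, h0]
  | succ n =>
    simpa using r.integral_law_mul_succ_eq_zero y n hf hC h0 (G := fun _ => 1) (K := 1)
      measurable_const (by simp)

/-- The strong law of large numbers for a bounded function of the periods with mean zero in every
state. -/
theorem ae_tendsto_average_zero (y : State) {f : Period → ℝ} {C : ℝ} (hf : Measurable f)
    (hC : ∀ z, |f z| ≤ C) (h0 : ∀ y', ∫ z, f z ∂r.periodLaw y' = 0) :
    ∀ᵐ ω ∂r.law y,
      Tendsto (fun n : ℕ => (∑ k ∈ Finset.range n, f (ω k)) / n) atTop (𝓝 0) := by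
  have hm : ∀ n, Measurable fun ω : ℕ → Period => f (ω n) := fun n =>
    hf.comp (measurable_pi_apply n)
  have hb : ∀ n (ω : ℕ → Period), |f (ω n)| ≤ C := fun n ω => hC _
  refine ae_tendsto_average_zero_of_orthogonal (P := r.law y) hm hb fun i j hij => ?_
  -- As $i\le n$, the earlier factor is a function of the periods up to $n$, so orthogonality to the
  -- past applies.
  obtain ⟨n, rfl⟩ : ∃ n, j = n + 1 := ⟨j - 1, by omega⟩
  have hi : i ∈ Finset.Iic n := Finset.mem_Iic.2 (by omega)
  have hG : Measurable fun x : Π _ : Finset.Iic n, Period => f (x ⟨i, hi⟩) :=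
    hf.comp (measurable_pi_apply (⟨i, hi⟩ : Finset.Iic n))
  have h := r.integral_law_mul_succ_eq_zero y n hf hC h0 hG (fun x => hC _)
  simpa only [Preorder.frestrictLe_apply] using h

/-- If a bounded function of the periods has a positive mean in every state, then its sums
eventually exceed a linear function. -/
theorem ae_eventually_linear_le_sum (y : State) {f : Period → ℝ} {C : ℝ} (hf : Measurable f)
    (hC : ∀ z, |f z| ≤ C) (h0 : ∀ y', 0 < ∫ z, f z ∂r.periodLaw y')
    (hst : ∀ y', ∀ᵐ z ∂r.periodLaw y', z.state = y') :
    ∃ c > 0, ∀ᵐ ω ∂r.law y, ∀ᶠ n : ℕ in atTop, c * n ≤ ∑ k ∈ Finset.range n, f (ω k) := by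
  set m : State → ℝ := fun y' => ∫ z, f z ∂r.periodLaw y' with hm
  have : Nonempty State := ⟨y⟩
  obtain ⟨y₀, hy₀⟩ := Finite.exists_min m
  have hfi : ∀ y', Integrable f (r.periodLaw y') := fun y' =>
    Integrable.of_bound hf.aestronglyMeasurable C (ae_of_all _ hC)
  have hmb : ∀ y', |m y'| ≤ C := fun y' => by
    have h := norm_integral_le_of_norm_le_const (μ := r.periodLaw y') (f := f) (ae_of_all _ hC)
    simpa using h
  have hmm : Measurable fun z : Period => m z.state :=
    Period.measurable_comp_state_event fun y' _ => m y'
  -- The smallest of the finitely many means is positive; half of it is given up to absorb the error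
  -- of the centred averages.
  refine ⟨m y₀ / 2, half_pos (h0 y₀), ?_⟩
  have key := r.ae_tendsto_average_zero y (f := fun z => f z - m z.state) (C := C + C)
    (hf.sub hmm) (fun z => (abs_sub _ _).trans (add_le_add (hC z) (hmb _))) (fun y' => by
      have e : (fun z : Period => f z - m z.state) =ᵐ[r.periodLaw y'] fun z => f z - m y' := by
        filter_upwards [hst y'] with z hz
        rw [hz]
      rw [integral_congr_ae e, integral_sub (hfi y') (integrable_const _)]
      simp [hm])
  filter_upwards [key] with ω hω
  filter_upwards [hω.eventually (lt_mem_nhds (by linarith [h0 y₀] : -(m y₀ / 2) < 0)),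
    eventually_gt_atTop 0] with n hn hn0
  have hn0' : (0 : ℝ) < n := by exact_mod_cast hn0
  rw [lt_div_iff₀ hn0', Finset.sum_sub_distrib] at hn
  have : (n : ℝ) * m y₀ ≤ ∑ k ∈ Finset.range n, m (ω k).state := by
    have := Finset.card_nsmul_le_sum (Finset.range n) (fun k => m (ω k).state) (m y₀)
      fun k _ => hy₀ _
    simpa using this
  linarith

end Rates

end MarkovMachine

/-! ### Pathwise counting and the clock -/

namespace MarkovMachine

instance : DecidableEq Event
  | .internal, .internal => isTrue rfl
  | .internal, .request => isFalse nofun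
  | .internal, .sample => isFalse nofun
  | .request, .internal => isFalse nofun
  | .request, .request => isTrue rfl
  | .request, .sample => isFalse nofun
  | .sample, .internal => isFalse nofun
  | .sample, .request => isFalse nofun
  | .sample, .sample => isTrue rfl

instance : DecidablePred Free := fun y => inferInstanceAs (Decidable (y.1.1 = 0))

instance : DecidablePred Accepts := fun y => inferInstanceAs (Decidable (y.1.2 = 0))

/-- A period that ends with a request. -/
def Requested (z : Period) : Prop := z.event = .request

/-- A period that ends with an acceptance. -/
def Accepted (z : Period) : Prop := z.event = .request ∧ Accepts z.state

/-- A period that ends with a false acceptance. -/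
def FalseAccepted (z : Period) : Prop := z.event = .request ∧ Accepts z.state ∧ ¬ Free z.state

/-- A period that ends with a rejection. -/
def Rejected (z : Period) : Prop := z.event = .request ∧ ¬ Accepts z.state

/-- A period that ends with a false rejection. -/
def FalseRejected (z : Period) : Prop := z.event = .request ∧ ¬ Accepts z.state ∧ Free z.state

open Classical in
/-- The number of periods with property `p` among the first `n`. -/
def tally (p : Period → Prop) (ω : ℕ → Period) (n : ℕ) : ℕ := Nat.count (fun k => p (ω k)) n

open Classical in
lemma tally_succ (p : Period → Prop) (ω : ℕ → Period) (n : ℕ) :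
    tally p ω (n + 1) = tally p ω n + if p (ω n) then 1 else 0 := Nat.count_succ ..

@[simp] lemma tally_zero (p : Period → Prop) (ω : ℕ → Period) : tally p ω 0 = 0 := by
  classical exact Nat.count_zero _

@[simp] lemma tally_true (ω : ℕ → Period) (n : ℕ) : tally (fun _ => True) ω n = n := by
  classical
  induction n with
  | zero => simp
  | succ n ih => simp [tally_succ, ih]

open Classical in
lemma sum_ite_eq_tally (p : Period → Prop) (ω : ℕ → Period) (n : ℕ) :
    ∑ k ∈ Finset.range n, (if p (ω k) then 1 else 0 : ℝ) = tally p ω n := by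
  induction n with
  | zero => simp
  | succ n ih => rw [Finset.sum_range_succ, ih, tally_succ]; push_cast; rfl

lemma tally_mono {p q : Period → Prop} (h : ∀ z, p z → q z) (ω : ℕ → Period) (n : ℕ) :
    tally p ω n ≤ tally q ω n := by
  classical
  induction n with
  | zero => simp
  | succ n ih =>
    rw [tally_succ, tally_succ]
    by_cases hp : p (ω n)
    · simp only [hp, h _ hp, if_true]; omega
    · simp only [hp, if_false]; omega

/-- Turns the linear growth of requests into linear growth of rejections, once acceptances are
bounded. -/
lemma tally_requested (ω : ℕ → Period) (n : ℕ) :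
    tally Requested ω n = tally Accepted ω n + tally Rejected ω n := by
  classical
  induction n with
  | zero => simp
  | succ n ih =>
    rw [tally_succ, tally_succ, tally_succ, ih]
    by_cases h1 : (ω n).event = .request <;> by_cases h2 : Accepts (ω n).state <;>
      simp [Requested, Accepted, Rejected, h1, h2] <;> omega

/-- A sequence of periods that starts in the initial state, obeys the dynamics, consists of periods
of positive length, and contains no sampling. -/
structure Regular (ω : ℕ → Period) : Prop where
  state_zero : (ω 0).state = start
  state_succ : ∀ n, (ω (n + 1)).state = (ω n).next
  hold_pos : ∀ n, 0 < (ω n).hold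
  event_ne : ∀ n, (ω n).event ≠ .sample

lemma accepts_step_internal (y : State) : Accepts (step y .internal) ↔ Accepts y := Iff.rfl

/-- A request at $\hat X=0$ sets $\hat X$ to $2$ or to a nonzero $X$; otherwise nothing changes. As
internal events leave $\hat X$ alone, $\hat X\ne0$ is absorbing without sampling. -/
lemma not_accepts_step_request (y : State) : ¬ Accepts (step y .request) := by
  simp only [step, Accepts]
  split_ifs with h1 h2
  · decide
  · exact h2
  · exact h1

/-- In a regular sequence of periods there is at most one acceptance, and the first request is
accepted. -/
lemma Regular.dichotomy {ω : ℕ → Period} (h : Regular ω) (n : ℕ) :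
    (tally Accepted ω n = 0 ∧ tally Requested ω n = 0 ∧ Accepts (ω n).state) ∨
      (tally Accepted ω n = 1 ∧ ¬ Accepts (ω n).state) := by
  classical
  induction n with
  | zero =>
    left
    rw [h.state_zero]
    exact ⟨tally_zero _ _, tally_zero _ _, rfl⟩
  | succ n ih =>
    rw [tally_succ, tally_succ, h.state_succ, Period.next]
    rcases he : (ω n).event with _ | _ | _
    · rw [accepts_step_internal]
      simpa [Accepted, Requested, he] using ih
    · right
      refine ⟨?_, not_accepts_step_request _⟩
      rcases ih with ⟨h1, -, h3⟩ | ⟨h1, h3⟩ <;> simp [Accepted, he, h1, h3]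
    · exact absurd he (h.event_ne n)

/-- If the number of requests tends to infinity, then from some period on, the single acceptance has
happened, and the number of false acceptances is constant. -/
lemma Regular.eventually_accepted {ω : ℕ → Period} (h : Regular ω)
    (hq : Tendsto (tally Requested ω) atTop atTop) :
    ∃ m, ∀ n ≥ m, ¬ Accepts (ω n).state ∧ tally Accepted ω n = 1 ∧
      tally FalseAccepted ω n = tally FalseAccepted ω m := by
  classical
  obtain ⟨m, hm⟩ := eventually_atTop.1 (hq.eventually_ge_atTop 1)
  have hA : ∀ n ≥ m, tally Accepted ω n = 1 ∧ ¬ Accepts (ω n).state := fun n hn => by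
    rcases h.dichotomy n with ⟨-, h2, -⟩ | h2
    · have := hm n hn
      omega
    · exact h2
  refine ⟨m, fun n hn => ⟨(hA n hn).2, (hA n hn).1, ?_⟩⟩
  induction n, hn using Nat.le_induction with
  | base => rfl
  | succ n hn ih => rw [tally_succ, ih]; simp [FalseAccepted, (hA n hn).2]

/-- The number of events up to a time, for a regular sequence of periods whose epochs are
unbounded. -/
lemma Regular.exists_clock {ω : ℕ → Period} (h : Regular ω)
    (he : Tendsto (epoch ω) atTop atTop) :
    ∃ M : ℝ → ℕ, Tendsto M atTop atTop ∧ (∀ p T, count ω p T = tally p ω (M T)) ∧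
      ∀ T, stateAt ω T = (ω (M T)).state := by
  classical
  have hmono : Monotone (epoch ω) := monotone_nat_of_le_succ fun n => by
    simp only [epoch]
    rw [Finset.sum_range_succ _ (n + 1)]
    linarith [h.hold_pos (n + 1)]
  have hex : ∀ T : ℝ, ∃ n, T < epoch ω n := fun T => (he.eventually_gt_atTop T).exists
  have hclock : ∀ T : ℝ, ∃ m, ∀ n, epoch ω n ≤ T ↔ n < m := fun T => by
    -- The first index whose epoch exceeds $T$; by monotonicity exactly the smaller indices have
    -- occurred by time $T$.
    refine ⟨Nat.find (hex T), fun n => ?_⟩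
    rw [Nat.lt_find_iff]
    exact ⟨fun hn m hm => not_lt.2 ((hmono hm).trans hn), fun hn => not_lt.1 (hn n le_rfl)⟩
  choose M hM using hclock
  have hcount : ∀ p T, count ω p T = tally p ω (M T) := fun p T => by
    have e : {n | epoch ω n ≤ T ∧ p (ω n)}
        = ((Finset.range (M T)).filter fun k => p (ω k) : Finset ℕ) := by
      ext n
      simp [hM]
    rw [count, tally, Nat.count_eq_card_filter_range, e, Set.ncard_coe_finset]
  refine ⟨M, ?_, hcount, fun T => ?_⟩
  · exact tendsto_atTop.2 fun b => (eventually_ge_atTop (epoch ω b)).mono fun T hT =>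
      ((hM T b).1 hT).le
  · rw [stateAt, hcount, tally_true]

/-! ### Potentials and Poisson equations -/

namespace Rates

variable (r : Rates)

/-- The probability of a false acceptance, as a function of the state. -/
def acceptancePotential (y : State) : ℝ :=
  -- First-step analysis: $(\lambda+\alpha)h_{00}=\alpha h_{10}$ and
  -- $(\lambda+\beta)h_{10}=\lambda+\beta h_{00}$; no false acceptance is possible once $\hat
  -- X\ne0$.
  ![![r.alpha / r.kappa, 0, 0], ![(r.lam + r.alpha) / r.kappa, 0, 0], ![0, 0, 0]] y.1.1 y.1.2

/-- A false acceptance, compensated by the change of the potential. -/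
def acceptanceDrift (y : State) (e : Event) : ℝ :=
  (if e = .request ∧ Accepts y ∧ ¬ Free y then 1 else 0) + r.acceptancePotential (step y e) - r.acceptancePotential y

/-- The solution of the Poisson equation for the excess of the number of false rejections over its
share of the number of rejections. -/
def rejectionPotential (y : State) : ℝ :=
  -- Normalised to $0$ at $X=1$, $\hat X\ne0$, the equations at $X=0$ and $X=1$ both give
  -- $\lambda/(\alpha+\beta)$ for $X=0$, and the one at $X=2$ gives $c$. For $\hat X=0$ the value is
  -- $c$ times the probability that the first request finds the machine free.
  let c := r.lam / (r.alpha + r.beta) - r.beta * r.lam / (r.gamma * (r.alpha + r.beta))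
  ![![(r.lam + r.beta) / r.kappa * c, r.lam / (r.alpha + r.beta), r.lam / (r.alpha + r.beta)],
    ![r.beta / r.kappa * c, 0, 0], ![0, 0, c]] y.1.1 y.1.2

/-- The excess of false rejections, compensated by the change of the potential. -/
def rejectionDrift (y : State) (e : Event) : ℝ :=
  (if e = .request ∧ ¬ Accepts y then (if Free y then 1 else 0) - r.beta / (r.alpha + r.beta)
    else 0) + r.rejectionPotential (step y e) - r.rejectionPotential y

lemma kappa_pos : 0 < r.kappa := add_pos (add_pos r.lam_pos r.alpha_pos) r.beta_pos

lemma integral_acceptanceDrift (hr : r.mu = 0) (y : State) :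
    ∫ z, r.acceptanceDrift z.state z.event ∂r.periodLaw y = 0 := by
  rw [integral_periodLaw, div_eq_zero_iff]
  left
  have hk := r.kappa_pos.ne'
  obtain ⟨⟨x, z⟩, hy⟩ := y
  -- The pairs $(2,0)$ and $(2,1)$ are excluded by `hy`; the others are the first-step equations.
  fin_cases x <;> fin_cases z <;>
    simp [acceptanceDrift, acceptancePotential, step, rate, internalRate, Accepts, Free, hr] at hy ⊢
  all_goals
    field_simp
    simp only [kappa]
    ring

lemma integral_rejectionDrift (hr : r.mu = 0) (y : State) :
    ∫ z, r.rejectionDrift z.state z.event ∂r.periodLaw y = 0 := by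
  rw [integral_periodLaw, div_eq_zero_iff]
  left
  have hk := r.kappa_pos.ne'
  have hg := r.gamma_pos.ne'
  have hab := (add_pos r.alpha_pos r.beta_pos).ne'
  obtain ⟨⟨x, z⟩, hy⟩ := y
  fin_cases x <;> fin_cases z <;>
    simp [rejectionDrift, rejectionPotential, step, rate, internalRate, Accepts, Free, hr] at hy ⊢
  all_goals
    field_simp
    try simp only [kappa]
    try ring

end Rates

open Rates

variable {r : Rates} {ω : ℕ → Period}

/-- The increments of the potential telescope, because each state is the `step` of the previous one.
-/
lemma Regular.sum_acceptanceDrift (h : Regular ω) (n : ℕ) :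
    ∑ k ∈ Finset.range n, r.acceptanceDrift (ω k).state (ω k).event
      = tally FalseAccepted ω n + r.acceptancePotential (ω n).state
        - r.acceptancePotential start := by
  classical
  induction n with
  | zero => simp [h.state_zero]
  | succ n ih =>
    rw [Finset.sum_range_succ, ih, tally_succ, h.state_succ, Period.next, acceptanceDrift]
    by_cases h0 : (ω n).event = .request ∧ Accepts (ω n).state ∧ ¬ Free (ω n).state <;>
      simp only [FalseAccepted, h0, if_false] <;> push_cast <;> ring

lemma Regular.sum_rejectionDrift (h : Regular ω) (n : ℕ) :
    ∑ k ∈ Finset.range n, r.rejectionDrift (ω k).state (ω k).event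
      = tally FalseRejected ω n - r.beta / (r.alpha + r.beta) * tally Rejected ω n
        + (r.rejectionPotential (ω n).state - r.rejectionPotential start) := by
  classical
  induction n with
  | zero => simp [h.state_zero]
  | succ n ih =>
    rw [Finset.sum_range_succ, ih, tally_succ, tally_succ, h.state_succ, Period.next,
      rejectionDrift]
    by_cases h0 : (ω n).event = .request <;> by_cases h1 : Accepts (ω n).state <;>
      by_cases h2 : Free (ω n).state <;>
      simp only [FalseRejected, Rejected, h0, h1, h2, not_true, not_false_eq_true, and_true,
        and_false, if_true, if_false] <;> push_cast <;> ring

/-- The proportion of false rejections among the rejections converges. -/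
lemma Regular.tendsto_rejection_ratio (h : Regular ω) {c : ℝ} (hc : 0 < c)
    (hq : ∀ᶠ n : ℕ in atTop, c * n ≤ tally Requested ω n)
    (hd : Tendsto (fun n : ℕ =>
      (∑ k ∈ Finset.range n, r.rejectionDrift (ω k).state (ω k).event) / n) atTop (𝓝 0)) :
    Tendsto (fun n => (tally FalseRejected ω n : ℝ) / tally Rejected ω n) atTop
      (𝓝 (r.beta / (r.alpha + r.beta))) := by
  obtain ⟨B, hB⟩ := Period.exists_bound
    fun y _ => r.rejectionPotential y - r.rejectionPotential start
  have hlim : Tendsto (fun n : ℕ => (|(∑ k ∈ Finset.range n,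
      r.rejectionDrift (ω k).state (ω k).event) / n| + B / n) * (2 / c)) atTop (𝓝 0) := by
    simpa using (hd.abs.add (tendsto_const_div_atTop_nhds_zero_nat B)).mul_const (2 / c)
  refine tendsto_iff_norm_sub_tendsto_zero.2 (squeeze_zero' (Eventually.of_forall fun n => norm_nonneg _) ?_ hlim)
  -- From $cn\ge2$ on, removing the single acceptance from the requests leaves at least $cn/2$
  -- rejections.
  filter_upwards [hq, eventually_ge_atTop ⌈2 / c⌉₊, eventually_gt_atTop 0] with n hn hn2 hn0
  have hn0' : (0 : ℝ) < n := by exact_mod_cast hn0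
  have hcn : 2 ≤ c * n := by
    have := Nat.ceil_le.1 hn2
    rw [div_le_iff₀ hc] at this
    linarith
  have hA : (tally Accepted ω n : ℝ) ≤ 1 := by
    rcases h.dichotomy n with h1 | h1 <;> simp [h1.1]
  have hR : c * n / 2 ≤ tally Rejected ω n := by
    rw [tally_requested] at hn
    push_cast at hn
    linarith
  have hR0 : (0 : ℝ) < tally Rejected ω n := by linarith
  have e : (tally FalseRejected ω n : ℝ) / tally Rejected ω n - r.beta / (r.alpha + r.beta)
      = (∑ k ∈ Finset.range n, r.rejectionDrift (ω k).state (ω k).event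
        - (r.rejectionPotential (ω n).state - r.rejectionPotential start))
          / tally Rejected ω n := by
    rw [h.sum_rejectionDrift, add_sub_cancel_right, sub_div, mul_div_cancel_right₀ _ hR0.ne']
  rw [e, Real.norm_eq_abs, abs_div, Nat.abs_cast, abs_div, Nat.abs_cast, ← add_div,
    div_mul_div_comm]
  refine (div_le_div_of_nonneg_left (abs_nonneg _) (by positivity) hR).trans ?_
  rw [div_div_eq_mul_div, mul_comm (n : ℝ) c]
  gcongr
  -- The event is a dummy argument here: the bounded function depends on the state only.
  exact (abs_sub _ _).trans (by gcongr; exact hB _ .sample)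

end MarkovMachine

/-! ### Almost sure behaviour and expectations -/

namespace MarkovMachine

namespace Rates

variable (r : Rates)

lemma ae_regular (hr : r.mu = 0) : ∀ᵐ ω ∂r.law start, Regular ω := by
  have h0 := r.ae_law_zero start (r.ae_periodLaw hr start)
  have h1 : ∀ᵐ ω ∂r.law start, ∀ n, (ω (n + 1)).state = (ω n).next ∧ 0 < (ω (n + 1)).hold ∧
      (ω (n + 1)).event ≠ .sample := by
    refine ae_all_iff.2 fun n => r.ae_law_succ start
      (p := fun y z => z.state = y ∧ 0 < z.hold ∧ z.event ≠ .sample) (r.ae_periodLaw hr) ?_ n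
    have m1 : MeasurableSet {x : State × Period | x.2.state = x.1} :=
      measurableSet_eq_fun (Period.measurable_state.comp measurable_snd) measurable_fst
    have m2 : MeasurableSet {x : State × Period | 0 < x.2.hold} :=
      measurableSet_lt measurable_const (Period.measurable_hold.comp measurable_snd)
    have me : Measurable fun x : State × Period => x.2.event :=
      Period.measurable_event.comp measurable_snd
    have m3 : MeasurableSet {x : State × Period | x.2.event ≠ .sample} :=
      (measurableSet_eq_fun me (measurable_const (a := Event.sample))).compl
    exact m1.inter (m2.inter m3)
  filter_upwards [h0, h1] with ω a b
  refine ⟨a.1, fun n => (b n).1, fun n => ?_, fun n => ?_⟩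
  · cases n with
    | zero => exact a.2.1
    | succ n => exact (b n).2.1
  · cases n with
    | zero => exact a.2.2
    | succ n => exact (b n).2.2

/-- The epochs almost surely tend to infinity. -/
lemma ae_tendsto_epoch (hr : r.mu = 0) : ∀ᵐ ω ∂r.law start, Tendsto (epoch ω) atTop atTop := by
  -- Truncating the lengths to $[0,1]$ makes the bounded law applicable; the means stay positive,
  -- since lengths are almost surely positive.
  have hm : Measurable fun z : Period => max 0 (min z.hold 1) :=
    measurable_const.max (Period.measurable_hold.min measurable_const)
  have hb : ∀ z : Period, |max 0 (min z.hold 1)| ≤ 1 := fun z => by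
    rw [abs_of_nonneg (le_max_left _ _)]
    exact max_le zero_le_one (min_le_right _ _)
  obtain ⟨c, hc, h⟩ := r.ae_eventually_linear_le_sum start hm hb (fun y => by
    rw [integral_pos_iff_support_of_nonneg (f := fun z : Period => max 0 (min z.hold 1))
      (fun z => le_max_left _ _) (Integrable.of_bound hm.aestronglyMeasurable 1 (ae_of_all _ hb))]
    refine lt_of_lt_of_eq zero_lt_one (Eq.symm ?_)
    rw [← prob_compl_eq_zero_iff (measurableSet_support hm)]
    refine measure_mono_null (fun z hz => ?_) (r.ae_periodLaw hr y)
    intro hz'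
    refine hz (ne_of_gt ?_)
    exact lt_max_of_lt_right (lt_min hz'.2.1 one_pos))
    (fun y => (r.ae_periodLaw hr y).mono fun z hz => hz.1)
  filter_upwards [h, r.ae_regular hr] with ω hω hreg
  have hlin : Tendsto (fun n : ℕ => c * n) atTop atTop :=
    tendsto_natCast_atTop_atTop.const_mul_atTop hc
  refine tendsto_atTop_mono' _ (hω.mono fun n hn => hn.trans ?_) hlin
  -- `epoch ω n` contains $n+1$ lengths; the last one is discarded.
  rw [epoch, Finset.sum_range_succ]
  refine le_add_of_le_of_nonneg (Finset.sum_le_sum fun k _ => ?_) (hreg.hold_pos n).le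
  exact max_le (hreg.hold_pos k).le (min_le_left _ _)

/-- The number of requests almost surely grows at least linearly. -/
lemma exists_ae_linear_le_requested (hr : r.mu = 0) :
    ∃ c : ℝ, 0 < c ∧ ∀ᵐ ω ∂r.law start, ∀ᶠ n : ℕ in atTop, c * n ≤ tally Requested ω n := by
  classical
  have hb : ∀ z : Period, |(if z.event = .request then 1 else 0 : ℝ)| ≤ 1 := fun z => by
    split_ifs <;> simp
  obtain ⟨c, hc, h⟩ := r.ae_eventually_linear_le_sum start
    (Period.measurable_comp_state_event fun _ e => if e = .request then (1 : ℝ) else 0) hb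
    (fun y => by
      rw [r.integral_periodLaw y fun _ e => if e = .request then 1 else 0]
      simpa [rate] using div_pos r.lam_pos (r.totalRate_pos y))
    (fun y => (r.ae_periodLaw hr y).mono fun z hz => hz.1)
  refine ⟨c, hc, h.mono fun ω hω => hω.mono fun n hn => ?_⟩
  rw [← sum_ite_eq_tally]
  exact hn.trans (le_of_eq (Finset.sum_congr rfl fun k _ => if_congr Iff.rfl rfl rfl))

lemma ae_tendsto_requested (hr : r.mu = 0) :
    ∀ᵐ ω ∂r.law start, Tendsto (tally Requested ω) atTop atTop := by
  obtain ⟨c, hc, h⟩ := r.exists_ae_linear_le_requested hr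
  filter_upwards [h] with ω hω
  exact tendsto_natCast_atTop_iff.1
    (tendsto_atTop_mono' _ hω (tendsto_natCast_atTop_atTop.const_mul_atTop hc))

theorem not_recurrent (hr : r.mu = 0) : ¬ r.Recurrent := by
  intro h
  have hfalse : ∀ᵐ _ω ∂r.law start, False := by
    filter_upwards [h start, r.ae_regular hr, r.ae_tendsto_epoch hr, r.ae_tendsto_requested hr]
      with ω h1 h2 h3 h4
    obtain ⟨M, hM, -, hst⟩ := h2.exists_clock h3
    obtain ⟨m, hm⟩ := h2.eventually_accepted h4
    obtain ⟨T, hT⟩ := eventually_atTop.1 (hM.eventually_ge_atTop m)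
    obtain ⟨t, ht, he⟩ := h1 T
    refine (hm _ (hT t ht)).1 ?_
    rw [← hst, he]
    rfl
  exact (IsProbabilityMeasure.ne_zero (r.law start)) (by simpa using hfalse)

lemma ae_limsupFR (hr : r.mu = 0) :
    ∀ᵐ ω ∂r.law start, limsupFR ω = r.beta / (r.alpha + r.beta) := by
  obtain ⟨c, hc, h⟩ := r.exists_ae_linear_le_requested hr
  obtain ⟨C, hC⟩ := Period.exists_bound r.rejectionDrift
  filter_upwards [h, r.ae_regular hr, r.ae_tendsto_epoch hr,
    r.ae_tendsto_average_zero start (Period.measurable_comp_state_event r.rejectionDrift)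
      (fun z => hC _ _) (r.integral_rejectionDrift hr)] with ω h1 h2 h3 h4
  obtain ⟨M, hM, hcount, -⟩ := h2.exists_clock h3
  refine (((h2.tendsto_rejection_ratio hc h1 h4).comp hM).congr fun T => ?_).limsup_eq
  rw [numFalseRejected, numRejected, hcount, hcount]
  rfl

/-- After the first request the denominator is $1$, the false acceptances are frozen and the
potential vanishes, so both sides are eventually the same constant. -/
lemma ae_tendsto_limsupFA (hr : r.mu = 0) : ∀ᵐ ω ∂r.law start,
    Tendsto (fun n => (tally FalseAccepted ω n : ℝ) + r.acceptancePotential (ω n).state) atTop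
      (𝓝 (limsupFA ω)) := by
  filter_upwards [r.ae_regular hr, r.ae_tendsto_epoch hr, r.ae_tendsto_requested hr]
    with ω h2 h3 h4
  obtain ⟨M, hM, hcount, -⟩ := h2.exists_clock h3
  obtain ⟨m, hm⟩ := h2.eventually_accepted h4
  have hlim : limsupFA ω = tally FalseAccepted ω m := by
    refine Tendsto.limsup_eq (tendsto_const_nhds.congr' ?_)
    filter_upwards [hM.eventually_ge_atTop m] with T hT
    rw [numFalseAccepted, numAccepted, hcount, hcount]
    change _ = (tally FalseAccepted ω (M T) : ℝ) / (tally Accepted ω (M T) : ℝ)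
    rw [(hm _ hT).2.1, (hm _ hT).2.2, Nat.cast_one, div_one]
  rw [hlim]
  refine tendsto_const_nhds.congr' ?_
  filter_upwards [eventually_ge_atTop m] with n hn
  have hpot : ∀ y : State, ¬ Accepts y → r.acceptancePotential y = 0 := by
    rintro ⟨⟨x, z⟩, hy⟩ h
    fin_cases x <;> fin_cases z <;> simp [acceptancePotential, Accepts] at h ⊢
  rw [hpot _ (hm n hn).1, (hm n hn).2.2, add_zero]

lemma integrable_limsupFA_and_integral (hr : r.mu = 0) :
    Integrable limsupFA (r.law start) ∧ r.FAR = r.alpha / r.kappa := by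
  obtain ⟨C, hC⟩ := Period.exists_bound r.acceptanceDrift
  obtain ⟨B, hB⟩ := Period.exists_bound fun y _ => r.acceptancePotential y
  have hdm := Period.measurable_comp_state_event r.acceptanceDrift
  -- Written with drifts, the martingale is measurable everywhere and visibly has constant mean; its
  -- form with tallies holds only almost surely, and gives the bound and the limit.
  set W : ℕ → (ℕ → Period) → ℝ := fun n ω =>
    ∑ k ∈ Finset.range n, r.acceptanceDrift (ω k).state (ω k).event
      + r.acceptancePotential start with hW
  have hWeq : ∀ n, ∀ᵐ ω ∂r.law start,
      W n ω = tally FalseAccepted ω n + r.acceptancePotential (ω n).state := fun n => by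
    filter_upwards [r.ae_regular hr] with ω h
    simp only [hW, h.sum_acceptanceDrift]
    ring
  have hWm : ∀ n, Measurable (W n) := fun n =>
    (Finset.measurable_sum _ fun k _ => hdm.comp (measurable_pi_apply k)).add_const _
  have hlim : ∀ᵐ ω ∂r.law start, Tendsto (fun n => W n ω) atTop (𝓝 (limsupFA ω)) := by
    filter_upwards [r.ae_tendsto_limsupFA hr, ae_all_iff.2 hWeq] with ω h1 h2
    exact h1.congr fun n => (h2 n).symm
  have hWb : ∀ n, ∀ᵐ ω ∂r.law start, ‖W n ω‖ ≤ 1 + B := fun n => by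
    filter_upwards [hWeq n, r.ae_regular hr] with ω h1 h2
    rw [h1]
    refine (norm_add_le _ _).trans (add_le_add ?_ (hB _ .sample))
    rw [Real.norm_natCast]
    have h3 : tally FalseAccepted ω n ≤ tally Accepted ω n :=
      tally_mono (fun z hz => ⟨hz.1, hz.2.1⟩) ω n
    have h4 : tally Accepted ω n ≤ 1 := by
      rcases h2.dichotomy n with h | h <;> omega
    exact_mod_cast h3.trans h4
  have hint : ∀ n, ∫ ω, W n ω ∂r.law start = r.alpha / r.kappa := fun n => by
    have hi : ∀ k, Integrable (fun ω : ℕ → Period =>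
        r.acceptanceDrift (ω k).state (ω k).event) (r.law start) := fun k =>
      Integrable.of_bound (hdm.comp (measurable_pi_apply k)).aestronglyMeasurable C
        (ae_of_all _ fun ω => hC _ _)
    have hz : ∀ k, ∫ ω, r.acceptanceDrift (ω k).state (ω k).event ∂r.law start = 0 := fun k =>
      r.integral_law_eq_zero start hdm (fun z => hC _ _) (r.integral_acceptanceDrift hr) k
    simp only [hW]
    rw [integral_add (integrable_finsetSum _ fun k _ => hi k) (integrable_const _),
      integral_finsetSum _ fun k _ => hi k]
    simp only [hz, Finset.sum_const_zero, zero_add, integral_const, probReal_univ, one_smul]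
    rfl
  -- Measurability of an upper limit over real times is obtained from the almost sure limit of `W`.
  have hmeas : AEStronglyMeasurable limsupFA (r.law start) :=
    aestronglyMeasurable_of_tendsto_ae atTop (fun n => (hWm n).aestronglyMeasurable) hlim
  refine ⟨Integrable.of_bound hmeas (1 + B) ?_, ?_⟩
  · filter_upwards [hlim, ae_all_iff.2 hWb] with ω h1 h2
    exact le_of_tendsto' h1.norm h2
  · have h := tendsto_integral_of_dominated_convergence (fun _ => 1 + B)
      (fun n => (hWm n).aestronglyMeasurable) (integrable_const _) hWb hlim
    simp only [hint] at h
    exact tendsto_nhds_unique h tendsto_const_nhds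

lemma integrable_limsupFR_and_integral (hr : r.mu = 0) :
    Integrable limsupFR (r.law start) ∧ r.FRR = r.beta / (r.alpha + r.beta) := by
  have h := r.ae_limsupFR hr
  refine ⟨(integrable_congr h).2 (integrable_const _), ?_⟩
  rw [FRR, integral_congr_ae h]
  simp

/-! ### Limits of the closed forms -/

lemma tendsto_closedFAR : Tendsto r.closedFAR (𝓝[>] 0) (𝓝 (r.alpha / r.kappa)) := by
  have h : ContinuousAt r.closedFAR 0 := by
    unfold closedFAR
    exact continuousAt_const.div (continuousAt_id.add continuousAt_const)
      (by simpa using r.kappa_pos.ne')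
  have e : r.closedFAR 0 = r.alpha / r.kappa := by simp [closedFAR]
  exact e ▸ h.tendsto.mono_left nhdsWithin_le_nhds

/-- At $m=0$ the denominator is $\gamma\lambda(\beta+\alpha)\kappa>0$, and $\gamma\lambda\kappa$
cancels. -/
lemma tendsto_closedFRR : Tendsto r.closedFRR (𝓝[>] 0) (𝓝 (r.beta / (r.alpha + r.beta))) := by
  have hk := r.kappa_pos
  have hg := r.gamma_pos
  have hl := r.lam_pos
  have ha := r.alpha_pos
  have hb := r.beta_pos
  have h : ContinuousAt r.closedFRR 0 := by
    unfold closedFRR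
    refine ContinuousAt.div (by fun_prop) (by fun_prop) ?_
    simp only [mul_zero, zero_add, ne_eq, OfNat.ofNat_ne_zero, not_false_eq_true, zero_pow]
    positivity
  have e : r.closedFRR 0 = r.beta / (r.alpha + r.beta) := by
    simp only [closedFRR, mul_zero, zero_add, zero_mul, ne_eq, OfNat.ofNat_ne_zero,
      not_false_eq_true, zero_pow]
    field_simp
    ring
  exact e ▸ h.tendsto.mono_left nhdsWithin_le_nhds

end Rates

end MarkovMachine

end

theorem theorem2 (r : MarkovMachine.Rates) (hr : r.mu = 0) :
    ¬ r.Recurrent ∧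
    Integrable MarkovMachine.limsupFA (r.law MarkovMachine.start) ∧
    Integrable MarkovMachine.limsupFR (r.law MarkovMachine.start) ∧
    Tendsto r.closedFAR (𝓝[>] 0) (𝓝 r.FAR) ∧
    Tendsto r.closedFRR (𝓝[>] 0) (𝓝 r.FRR) ∧
    r.FAR = r.alpha / (r.lam + r.alpha + r.beta) ∧
    r.FRR = r.beta / (r.alpha + r.beta) := by
  obtain ⟨hA, eA⟩ := r.integrable_limsupFA_and_integral hr
  obtain ⟨hR, eR⟩ := r.integrable_limsupFR_and_integral hr
  refine ⟨r.not_recurrent hr, hA, hR, ?_, ?_, eA, eR⟩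
  · rw [eA]
    exact r.tendsto_closedFAR
  · rw [eR]
    exact r.tendsto_closedFRR
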